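/- **Theorem 3.2 (Uniform Comparison Theorem).** Let $\mathcal M$ be a matroid of rank $r$ on the ground set $[m]=\{1,\dots,m\}$ and let $\rho:[m]\to\mathbb F^n$, $i\mapsto\boldsymbol\rho_i$, be a representation of $\mathcal M$ over a field $\mathbb F$ (a set $J\subseteq[m]$ is independent in $\mathcal M$ iff the family $(\boldsymbol\rho_j)_{j\in J}$ is linearly independent). For an arrangement $\mathcal A$ in a finite-dimensional vector space $V$, let $L(\mathcal A)$ be the set of all nonempty intersections of members of $\mathcal A$, including $V$, ordered by reverse inclusion (its elements are called flats of $\mathcal A$), and let $\chi(\mathcal A,t)=\sum_{X\in L(\mathcal A)}\mu(V,X)\,t^{\dim X}$, where $\mu$ is the Möbius function of $L(\mathcal A)$. For $X\in L(\mathcal A)$ let $M(\mathcal A/X)=X\setminus\bigcup_{H\in\mathcal A,\ X\not\subseteq H}(H\cap X)$. For $\mathbf g\in\mathbb F^m$ let $\mathcal A_{\mathbf g}$ be the arrangement in $\mathbb F^n$ with members $\{\mathbf x:\boldsymbol\rho_i\cdot\mathbf x=g_i\}$, $1\le i\le m$. Let $\mathcal A^\rho$ be the arrangement in $\mathbb F^m$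 of the hyperplanes $H_I=\{\mathbf y:\mathbf c_I\cdot\mathbf y=0\}$, $I$ a circuit of $\mathcal M$, where $\mathbf c_I=(c_1,\dots,c_m)$ is the vector, unique up to a nonzero scalar, with $\sum_i c_i\boldsymbol\rho_i=0$ and $c_i\ne0$ exactly for $i\in I$. Let $\chi(\mathcal M,t)=\sum_{S}\mu(\operatorname{cl}\emptyset,S)\,t^{n-r(S)}$, the sum over the lattice of flats of $\mathcal M$, where $r(S)$ is the rank of $S$ in $\mathcal M$. Then, for every $X\in L(\mathcal A^\rho)$, the polynomial $\chi(\mathcal A_{\mathbf g},t)$ is the same for all $\mathbf g\in M(\mathcal A^\rho/X)$; it is denoted $\chi(X,t)$ whenever $M(\mathcal A^\rho/X)\neq\emptyset$, which is always the case if $\mathbb F$ is infinite. For $0\le k\le r$ let $(-1)^ka_k(\mathcal M)$, $(-1)^ka_k(\mathbf g)$, $(-1)^ka_k(X)$ be the coefficients of $t^{n-k}$ in $\chi(\mathcal M,t)$, $\chi(\mathcal A_{\mathbf g},t)$, $\chi(X,t)$ respectively. If $X\subseteq Y$ are flats of $\mathcal A^\rho$ such that $M(\mathcal A^\rho/X)$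 and $M(\mathcal A^\rho/Y)$ are nonempty, then $$a_k(X)\le a_k(Y),\qquad 0\le k\le r.$$ In particular, $$a_k(\mathcal M)\le a_k(\mathbf g)\qquad\text{for all }\mathbf g\in\mathbb F^m\text{ and }0\le k\le r.$$ -/

import Mathlib

open Polynomial

noncomputable section

namespace TranslationDeformation

section Moebius

/-- The Möbius function of a finite poset (Mathlib's `IncidenceAlgebra.mu` over `ℤ`). -/
def moebius {P : Type*} [PartialOrder P] [Finite P] (x y : P) : ℤ :=
  letI : Fintype P := Fintype.ofFinite P
  letI : DecidableEq P := Classical.decEq P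
  letI : DecidableLE P := Classical.decRel _
  letI : DecidableLT P := Classical.decRel _
  letI : LocallyFiniteOrder P := Fintype.toLocallyFiniteOrder
  IncidenceAlgebra.mu ℤ x y

/-- The `k`-th unsigned coefficient of `P` relative to the exponent `d`: the number `a_k` in an
expansion `P = a_0 t^d - a_1 t^(d-1) + ⋯ + (-1)^r a_r t^(d-r)`. It is only used for `k ≤ d`. -/
def unsignedCoeff (d : ℕ) (P : ℤ[X]) (k : ℕ) : ℤ := (-1) ^ k * P.coeff (d - k)

end Moebius

section Arrangement

variable {F V ι : Type*} [Field F] [AddCommGroup V] [Module F V]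

/-- The intersection semi-lattice `L(A)` of an arrangement `A = (A i)_i` in `V`, as a set: all
nonempty intersections of members of `A`, including `V` itself (the intersection of the empty
family). -/
def flats (A : ι → AffineSubspace F V) : Set (AffineSubspace F V) :=
  {X | X ≠ ⊥ ∧ ∃ J : Set ι, X = ⨅ j ∈ J, A j}

theorem top_mem_flats (A : ι → AffineSubspace F V) : (⊤ : AffineSubspace F V) ∈ flats A :=
  ⟨AffineSubspace.bot_ne_top F V V |>.symm, ∅, by simp⟩

instance flats_finite [Finite ι] (A : ι → AffineSubspace F V) : Finite (flats A) :=
  ((Set.finite_range fun J : Set ι => ⨅ j ∈ J, A j).subset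
    (by rintro X ⟨-, J, rfl⟩; exact ⟨J, rfl⟩)).to_subtype

/-- The characteristic polynomial `χ(A, t) = ∑_{X ∈ L(A)} μ(V, X) t^(dim X)`, where `L(A)` is
ordered by reverse inclusion (whence the `OrderDual`). -/
def charPoly [Finite ι] (A : ι → AffineSubspace F V) : ℤ[X] :=
  letI : Fintype (flats A) := Fintype.ofFinite _
  ∑ W : flats A,
    Polynomial.C (moebius (P := (flats A)ᵒᵈ)
        (OrderDual.toDual ⟨⊤, top_mem_flats A⟩) (OrderDual.toDual W)) *
      (Polynomial.X : ℤ[X]) ^ Module.finrank F (W : AffineSubspace F V).direction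

/-- The complement `M(A/X)` of the restriction of `A` to `X`: the points of `X` that lie on no
hyperplane `A i ∩ X` of the restriction, `i` ranging over the indices with `X ⊄ A i`. -/
def restrictionComplement (A : ι → AffineSubspace F V) (X : AffineSubspace F V) : Set V :=
  (X : Set V) \ ⋃ (i : ι) (_ : ¬ X ≤ A i), ((A i : Set V) ∩ (X : Set V))

end Arrangement

section Representation

variable {F : Type*} [Field F] {m n : ℕ}

/-- `ρ : [m] → F^n` is a representation of the matroid `M` on the ground set `[m]`: a set of
indices is independent in `M` iff the corresponding family of vectors is linearly independent. -/
structure IsRepresentation (M : Matroid (Fin m)) (ρ : Fin m → Fin n → F) : Prop where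
  ground_eq : M.E = Set.univ
  indep_iff : ∀ I : Set (Fin m), M.Indep I ↔ LinearIndepOn F ρ I

/-- The affine subspace `{x ∈ F^n | v · x = c}`. -/
def affineHyperplane (v : Fin n → F) (c : F) : AffineSubspace F (Fin n → F) where
  carrier := {x | v ⬝ᵥ x = c}
  smul_vsub_vadd_mem' := by
    intro a p q r hp hq hr
    simp only [Set.mem_ofPred_eq] at hp hq hr ⊢
    simp [dotProduct_add, dotProduct_smul, dotProduct_sub, hp, hq, hr]

/-- The translated arrangement `A_g`, with members `ρ_i · x = g_i`. -/
def translatedArrangement (ρ : Fin m → Fin n → F) (g : Fin m → F) : Fin m → AffineSubspace F (Fin n → F) :=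
  fun i => affineHyperplane (ρ i) (g i)

/-- `c` is a circuit vector for `I`: a linear relation among the `ρ_i` with support `I`. For a
circuit `I` such a vector exists and is unique up to a nonzero scalar. -/
def IsCircuitVector (ρ : Fin m → Fin n → F) (I : Set (Fin m)) (c : Fin m → F) : Prop :=
  ∑ i, c i • ρ i = 0 ∧ ∀ i, c i ≠ 0 ↔ i ∈ I

/-- The linear hyperplane `H_I : c_I · y = 0` in `F^m`. As `c_I` is only unique up to a nonzero
scalar, all circuit vectors of `I` are used; they define the same hyperplane. -/
def circuitHyperplane (ρ : Fin m → Fin n → F) (I : Set (Fin m)) : Submodule F (Fin m → F) where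
  carrier := {y | ∀ c, IsCircuitVector ρ I c → c ⬝ᵥ y = 0}
  add_mem' := by
    intro y z hy hz c hc
    rw [dotProduct_add, hy c hc, hz c hc, add_zero]
  zero_mem' := fun c _ => dotProduct_zero c
  smul_mem' := by
    intro a y hy c hc
    rw [dotProduct_smul, hy c hc, smul_zero]

/-- The arrangement `A^ρ` of the hyperplanes `H_I`, where `I` runs over the circuits of `M`. -/
def circuitArrangement (M : Matroid (Fin m)) (ρ : Fin m → Fin n → F) :
    {I : Set (Fin m) // M.IsCircuit I} → AffineSubspace F (Fin m → F) :=
  fun I => (circuitHyperplane ρ I.1).toAffineSubspace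

/-- The complement `M(A^ρ/X)`. -/
def stratum (M : Matroid (Fin m)) (ρ : Fin m → Fin n → F)
    (X : AffineSubspace F (Fin m → F)) : Set (Fin m → F) :=
  restrictionComplement (circuitArrangement M ρ) X

open Classical in
/-- The polynomial `χ(X, t)`: the common value of `χ(A_g, t)` for `g ∈ M(A^ρ/X)`. It is obtained
from a chosen `g`, and has no meaning if `M(A^ρ/X)` is empty. -/
def flatCharPoly (M : Matroid (Fin m)) (ρ : Fin m → Fin n → F)
    (X : AffineSubspace F (Fin m → F)) : ℤ[X] :=
  if h : (stratum M ρ X).Nonempty then charPoly (translatedArrangement ρ h.some) else 0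

/-- The characteristic polynomial of the matroid `M`, in the normalization of degree `n`:
`χ(M, t) = ∑_S μ(cl ∅, S) t^(n - r(S))`, summed over the lattice of flats `S` of `M`. -/
def matroidCharPoly (M : Matroid (Fin m)) (n : ℕ) : ℤ[X] :=
  letI : Fintype {S : Set (Fin m) // M.IsFlat S} := Fintype.ofFinite _
  ∑ S : {S : Set (Fin m) // M.IsFlat S},
    Polynomial.C (moebius (P := {S : Set (Fin m) // M.IsFlat S})
        ⟨M.closure ∅, M.isFlat_closure ∅⟩ S) *
      (Polynomial.X : ℤ[X]) ^ (n - (M.eRk S.1).toNat)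

/-- `a_k(M)` -/
def coeffMatroid (M : Matroid (Fin m)) (n k : ℕ) : ℤ := unsignedCoeff n (matroidCharPoly M n) k

/-- `a_k(g)` -/
def coeffVector (ρ : Fin m → Fin n → F) (g : Fin m → F) (k : ℕ) : ℤ :=
  unsignedCoeff n (charPoly (translatedArrangement ρ g)) k

/-- `a_k(X)` -/
def coeffFlat (M : Matroid (Fin m)) (ρ : Fin m → Fin n → F)
    (X : AffineSubspace F (Fin m → F)) (k : ℕ) : ℤ :=
  unsignedCoeff n (flatCharPoly M ρ X) k

end Representation

end TranslationDeformation

end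

open TranslationDeformation

open Polynomial

namespace TranslationDeformation

/-! ### Möbius function of a finite poset with least element -/

section Moebius

variable {P : Type*} [PartialOrder P]

/-! Both characteristic polynomials are computed by one broken circuit theorem
(`sum_moebius_eq_nbcPoly`): `a_k` counts the `k`-element independent sets of `M` that contain no `C
\ {min C}` with `C` in a set `𝒞` of circuits. For `M` itself `𝒞` is all circuits
(`matroidCharPoly_eq_nbcPoly`); for `A_g` it is those with `g ∈ H_C`
(`charPoly_translatedArrangement`), the circuits whose equations are compatible. For `g` in the
stratum of `X`, `g ∈ H_C` iff `X ⊆ H_C`, so the polynomial depends only on `X`. A larger flat lies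
in fewer hyperplanes, hence forbids fewer broken circuits and admits more sets
(`unsignedCoeff_nbcPoly_anti`). -/

open Classical in
theorem sum_moebius_le [Fintype P] (x y : P) (h : ∀ z, x ≤ z) :
    ∑ z with z ≤ y, moebius x z = if x = y then 1 else 0 := by
  let _ : DecidableLE P := Classical.decRel _
  let _ : DecidableLT P := Classical.decRel _
  let _ : LocallyFiniteOrder P := Fintype.toLocallyFiniteOrder
  have key := IncidenceAlgebra.sum_Icc_mu_right (𝕜 := ℤ) x y
  convert key using 1
  · refine Finset.sum_congr ?_ fun z _ => ?_
    · ext z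
      simp [h z]
    · unfold moebius
      congr!

open Classical in
theorem moebius_eq_of_sum_le [Fintype P] (x : P) (h : ∀ z, x ≤ z) (N : P → ℤ)
    (hN : ∀ y, ∑ z with z ≤ y, N z = if x = y then 1 else 0) (y : P) : moebius x y = N y := by
  induction y using (wellFounded_lt (α := P)).induction with
  | _ y ih =>
    have h1 := (sum_moebius_le x y h).trans (hN y).symm
    have hsplit : (Finset.univ.filter fun z => z ≤ y) =
        insert y (Finset.univ.filter fun z => z < y) := by
      ext z
      simp [le_iff_eq_or_lt]
    rw [hsplit, Finset.sum_insert (by simp), Finset.sum_insert (by simp),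
      Finset.sum_congr rfl (g := N) fun z hz => ih z (by simpa using hz)] at h1
    exact add_right_cancel h1

end Moebius

/-! ### Broken circuits relative to a set of circuits -/

section BrokenCircuit

variable {α : Type*} [LinearOrder α]

/-- `B` is independent and contains no broken circuit `C \ {min C}`, where `C` runs over the
circuits in `𝒞` that are not loops. -/
def IsNBC (M : Matroid α) (𝒞 : Set (Set α)) (B : Set α) : Prop :=
  M.Indep B ∧ ∀ C ∈ 𝒞, M.IsCircuit C → C.Nontrivial → ∀ e, IsLeast C e → ¬ C \ {e} ⊆ B

/-- The sets `S` that behave like flats of the semimatroid whose circuits are the circuits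
of `M` in `𝒞`, except that they contain no loops. -/
structure IsLooplessFlat (M : Matroid α) (𝒞 : Set (Set α)) (S : Set α) : Prop where
  indep_singleton : ∀ i ∈ S, M.Indep {i}
  mem_of_subset : ∀ C, M.IsCircuit C → C ⊆ S → C ∈ 𝒞
  mem_of_diff_subset : ∀ C ∈ 𝒞, M.IsCircuit C → C.Nontrivial → ∀ e ∈ C, C \ {e} ⊆ S → e ∈ S

variable {M : Matroid α} {𝒞 𝒟 : Set (Set α)}

theorem IsNBC.subset {B B' : Set α} (h : IsNBC M 𝒞 B) (hB : B' ⊆ B) : IsNBC M 𝒞 B' :=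
  ⟨h.1.subset hB, fun C hC hC' hn e he hs => h.2 C hC hC' hn e he (hs.trans hB)⟩

theorem IsNBC.anti {B : Set α} (h : IsNBC M 𝒟 B) (hs : 𝒞 ⊆ 𝒟) : IsNBC M 𝒞 B :=
  ⟨h.1, fun C hC => h.2 C (hs hC)⟩

theorem isNBC_empty : IsNBC M 𝒞 ∅ := by
  refine ⟨M.empty_indep, fun C _ _ hn e _ hs => ?_⟩
  obtain ⟨x, hx, hxe⟩ := hn.exists_ne e
  exact hs ⟨hx, hxe⟩

/-- A circuit created by adding `s` would lie in `𝒞` and have minimum `s`, so `B` already contained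
its broken circuit. A broken circuit `C \ {e}` created by adding `s` is impossible: closure puts `e`
in `S`, so `s ≤ e`, while `s ∈ C \ {e}` would exceed `e`. -/
theorem IsNBC.insert_least [Finite α] {B S : Set α} {s : α} (hB : IsNBC M 𝒞 B)
    (hS : IsLooplessFlat M 𝒞 S) (hBS : B ⊆ S) (hs : IsLeast S s) : IsNBC M 𝒞 (insert s B) := by
  have hins : insert s B ⊆ S := Set.insert_subset hs.1 hBS
  constructor
  · by_contra hdep
    have hE : insert s B ⊆ M.E :=
      Set.insert_subset ((hS.indep_singleton s hs.1).subset_ground rfl) hB.1.subset_ground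
    obtain ⟨C, hCB, hC⟩ := (Matroid.not_indep_iff hE |>.1 hdep).exists_isCircuit_subset
    have hCS := hCB.trans hins
    have hsC : s ∈ C := by
      by_contra hsC
      exact hC.not_indep (hB.1.subset ((Set.subset_insert_iff_of_notMem hsC).1 hCB))
    have hn : C.Nontrivial := by
      by_contra hn
      rw [Set.not_nontrivial_iff] at hn
      have : C = {s} := hn.eq_singleton_of_mem hsC
      exact hC.not_indep (this ▸ hS.indep_singleton s hs.1)
    refine hB.2 C (hS.mem_of_subset C hC hCS) hC hn s ⟨hsC, fun x hx => hs.2 (hCS hx)⟩ ?_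
    rintro x ⟨hx, hxs⟩
    exact (hCB hx).resolve_left hxs
  · intro C hC hC' hn e he hsub
    have heS := hS.mem_of_diff_subset C hC hC' hn e he.1 (hsub.trans hins)
    refine hB.2 C hC hC' hn e he fun x hx => (hsub hx).resolve_left ?_
    rintro rfl
    exact hx.2 (le_antisymm (hs.2 heS) (he.2 hx.1))

variable [Fintype α]

open Classical in
/-- The `Finset` of all `IsNBC` sets. -/
noncomputable def nbcSets (M : Matroid α) (𝒞 : Set (Set α)) : Finset (Finset α) :=
  Finset.univ.filter fun B : Finset α => IsNBC M 𝒞 (B : Set α)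

@[simp]
theorem mem_nbcSets {B : Finset α} : B ∈ nbcSets M 𝒞 ↔ IsNBC M 𝒞 B := by
  simp [nbcSets]

open Classical in
-- Toggling the least element of a nonempty `S` is a sign-reversing involution without fixed points.
theorem sum_nbcSets_subset (S : Set α) (hS : IsLooplessFlat M 𝒞 S) :
    ∑ B ∈ (nbcSets M 𝒞).filter fun B : Finset α => (B : Set α) ⊆ S, (-1 : ℤ) ^ B.card =
      if S = ∅ then 1 else 0 := by
  split_ifs with h
  · subst h
    have : ((nbcSets M 𝒞).filter fun B : Finset α => (B : Set α) ⊆ ∅) = {∅} := by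
      ext B
      simp only [Finset.mem_filter, mem_nbcSets, Set.subset_empty_iff,
        Finset.coe_eq_empty, Finset.mem_singleton, and_iff_right_iff_imp]
      rintro rfl
      simpa using isNBC_empty
    rw [this]
    simp
  · obtain ⟨s, hs, hmin⟩ := Set.exists_min_image S id S.toFinite (Set.nonempty_iff_ne_empty.2 h)
    have hs : IsLeast S s := ⟨hs, hmin⟩
    refine Finset.sum_involution (fun B _ => if s ∈ B then B.erase s else insert s B) ?_ ?_ ?_ ?_
    · intro B _
      split_ifs with hB
      · rw [← Finset.card_erase_add_one hB]
        ring
      · rw [Finset.card_insert_of_notMem hB]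
        ring
    · intro B _ _
      split_ifs with hB
      · exact fun h => Finset.notMem_erase s B (by rwa [h])
      · exact fun h => hB (by rw [← h]; exact Finset.mem_insert_self s B)
    · intro B hB
      simp only [Finset.mem_filter, mem_nbcSets] at hB ⊢
      split_ifs with hsB
      · have : ((B.erase s : Finset α) : Set α) ⊆ B := by simp
        exact ⟨hB.1.subset this, this.trans hB.2⟩
      · rw [Finset.coe_insert]
        exact ⟨hB.1.insert_least hS hB.2 hs, Set.insert_subset hs.1 hB.2⟩
    · intro B _
      by_cases hsB : s ∈ B <;> simp [hsB]

/-- The signed generating polynomial of the `IsNBC` sets, in the normalization of degree `n`. -/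
noncomputable def nbcPoly (M : Matroid α) (𝒞 : Set (Set α)) (n : ℕ) : ℤ[X] :=
  ∑ B ∈ nbcSets M 𝒞, C ((-1 : ℤ) ^ B.card) * X ^ (n - B.card)

open Classical in
/-- Broken circuit theorem for a finite poset whose elements `x` are labelled by the loopless
flats `supp x`. -/
theorem sum_moebius_eq_nbcPoly {P : Type*} [PartialOrder P] [Fintype P] (x₀ : P)
    (hx₀ : ∀ x, x₀ ≤ x) (f : Finset α → P) (supp : P → Set α)
    (hf : ∀ B : Finset α, IsNBC M 𝒞 B → ∀ x, f B ≤ x ↔ (B : Set α) ⊆ supp x)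
    (hsupp : ∀ x, IsLooplessFlat M 𝒞 (supp x)) (hempty : ∀ x, supp x = ∅ ↔ x₀ = x)
    (d : P → ℕ) (n : ℕ) (hd : ∀ B : Finset α, IsNBC M 𝒞 B → d (f B) = n - B.card) :
    ∑ x, C (moebius x₀ x) * (X : ℤ[X]) ^ d x = nbcPoly M 𝒞 n := by
  have hmu : ∀ x, moebius x₀ x =
      ∑ B ∈ nbcSets M 𝒞 with f B = x, (-1 : ℤ) ^ B.card := by
    -- The signed fibre counts of `f` satisfy the Möbius recursion: the NBC sets with `f B ≤ y` are
    -- exactly those inside `supp y`.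
    refine moebius_eq_of_sum_le x₀ hx₀ _ fun y => ?_
    rw [← if_congr (hempty y) rfl rfl, ← sum_nbcSets_subset _ (hsupp y)]
    rw [← Finset.sum_fiberwise_of_maps_to (t := Finset.univ.filter fun z => z ≤ y) (g := f)]
    · refine Finset.sum_congr rfl fun z hz => Finset.sum_congr ?_ fun _ _ => rfl
      ext B
      simp only [Finset.mem_filter, Finset.mem_univ, true_and, mem_nbcSets] at hz ⊢
      constructor
      · rintro ⟨hB, rfl⟩
        exact ⟨⟨hB, (hf B hB y).1 hz⟩, rfl⟩
      · rintro ⟨⟨hB, -⟩, h⟩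
        exact ⟨hB, h⟩
    · intro B hB
      simp only [Finset.mem_filter, Finset.mem_univ, true_and, mem_nbcSets] at hB ⊢
      exact (hf B hB.1 y).2 hB.2
  unfold nbcPoly
  rw [← Finset.sum_fiberwise_of_maps_to (t := Finset.univ) (g := f) (fun _ _ => Finset.mem_univ _)]
  refine Finset.sum_congr rfl fun x _ => ?_
  rw [hmu x, map_sum, Finset.sum_mul]
  refine Finset.sum_congr rfl fun B hB => ?_
  simp only [Finset.mem_filter, mem_nbcSets] at hB
  rw [← hB.2, hd B hB.1]

open Classical in
theorem unsignedCoeff_nbcPoly {n k : ℕ} (hk : k ≤ n) (hn : ∀ B : Finset α, M.Indep B → B.card ≤ n) :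
    unsignedCoeff n (nbcPoly M 𝒞 n) k =
      ((nbcSets M 𝒞).filter fun B => B.card = k).card := by
  unfold unsignedCoeff nbcPoly
  rw [Polynomial.finsetSum_coeff, Finset.mul_sum, Finset.card_filter, Nat.cast_sum]
  refine Finset.sum_congr rfl fun B hB => ?_
  have := hn B (mem_nbcSets.1 hB).1
  rw [Polynomial.coeff_C_mul, Polynomial.coeff_X_pow]
  by_cases hBk : B.card = k
  · simp [hBk, ← mul_pow]
  -- Both sizes are at most `n`, so neither subtraction truncates.
  · have : n - k ≠ n - B.card := by omega
    simp [hBk, this]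

theorem unsignedCoeff_nbcPoly_anti {n k : ℕ} (hk : k ≤ n)
    (hn : ∀ B : Finset α, M.Indep B → B.card ≤ n) (h : 𝒞 ⊆ 𝒟) :
    unsignedCoeff n (nbcPoly M 𝒟 n) k ≤ unsignedCoeff n (nbcPoly M 𝒞 n) k := by
  classical
  rw [unsignedCoeff_nbcPoly hk hn, unsignedCoeff_nbcPoly hk hn, Nat.cast_le]
  refine Finset.card_le_card fun B hB => ?_
  simp only [Finset.mem_filter, mem_nbcSets] at hB ⊢
  exact ⟨hB.1.anti h, hB.2⟩

end BrokenCircuit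

/-! ### The matroid side: all circuits -/

section MatroidFlats

variable {m : ℕ} (M : Matroid (Fin m))

theorem isLooplessFlat_diff_loops (hE : M.E = Set.univ) {S : Set (Fin m)} (hS : M.IsFlat S) :
    IsLooplessFlat M Set.univ (S \ M.loops) where
  indep_singleton i hi := by
    rw [Matroid.indep_singleton]
    exact Matroid.isNonloop_of_not_isLoop (by simp [hE]) hi.2
  mem_of_subset _ _ _ := Set.mem_univ _
  mem_of_diff_subset C _ hC hn e he hsub := by
    refine ⟨?_, fun hl => ?_⟩
    · rw [← hS.closure]
      exact M.closure_subset_closure (hsub.trans Set.sdiff_subset)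
        (hC.mem_closure_sdiff_singleton_of_mem he)
    · exact hn.ne_singleton (Matroid.IsLoop.eq_of_isCircuit_mem hl hC he)

theorem matroidCharPoly_eq_nbcPoly (hE : M.E = Set.univ) (n : ℕ) :
    matroidCharPoly M n = nbcPoly M Set.univ n := by
  unfold matroidCharPoly
  refine @sum_moebius_eq_nbcPoly _ _ M Set.univ _ _ _ (Fintype.ofFinite _) _ ?_
    (fun B => ⟨M.closure B, M.isFlat_closure B⟩) (fun S => S.1 \ M.loops) ?_
    (fun S => isLooplessFlat_diff_loops M hE S.2) ?_ _ n ?_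
  · intro S
    exact S.2.loops_subset
  · intro B hB S
    rw [Subtype.mk_le_mk, Set.subset_sdiff]
    constructor
    · intro h
      refine ⟨(M.subset_closure B hB.1.subset_ground).trans h, ?_⟩
      rw [Set.disjoint_left]
      exact fun i hi hl => Matroid.IsLoop.notMem_of_indep hl hB.1 hi
    · intro h
      have := M.closure_subset_closure h.1
      rwa [S.2.closure] at this
  · intro S
    rw [Set.sdiff_eq_empty, Subtype.ext_iff]
    exact ⟨fun h => Set.Subset.antisymm S.2.loops_subset h, fun h => h ▸ subset_rfl⟩
  · intro B hB
    simp only [Matroid.eRk_closure_eq, hB.1.eRk_eq_encard, Set.encard_coe_eq_coe_finsetCard,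
      ENat.toNat_natCast]

end MatroidFlats

/-! ### The arrangement side: circuits whose hyperplane contains `g` -/

section Arrangement

variable {F : Type*} [Field F] {m n : ℕ} {M : Matroid (Fin m)} {ρ : Fin m → Fin n → F}

/-- The circuits `C` of the representation whose hyperplane contains `g`. -/
def centralCircuits (ρ : Fin m → Fin n → F) (g : Fin m → F) : Set (Set (Fin m)) :=
  {C | g ∈ circuitHyperplane ρ C}

theorem mem_iInf_translatedArrangement {g : Fin m → F} {J : Set (Fin m)} {x : Fin n → F} :
    x ∈ ⨅ j ∈ J, translatedArrangement ρ g j ↔ ∀ j ∈ J, ρ j ⬝ᵥ x = g j := by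
  simp only [AffineSubspace.mem_iInf_iff]
  rfl

/-- The linear map `x ↦ (ρ_i · x)_{i ∈ B}`. -/
def evalOn (ρ : Fin m → Fin n → F) (B : Finset (Fin m)) : (Fin n → F) →ₗ[F] (B → F) :=
  (Matrix.of fun i : B => ρ i).mulVecLin

theorem evalOn_apply (B : Finset (Fin m)) (x : Fin n → F) (i : B) :
    evalOn ρ B x i = ρ i ⬝ᵥ x := rfl

theorem finrank_range_evalOn {B : Finset (Fin m)} (hB : LinearIndepOn F ρ (B : Set (Fin m))) :
    Module.finrank F (LinearMap.range (evalOn ρ B)) = B.card := by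
  have h : LinearIndependent F (Matrix.of fun i : B => ρ i).row := hB
  have := h.rank_matrix
  rwa [Fintype.card_coe] at this

theorem evalOn_surjective {B : Finset (Fin m)} (hB : LinearIndepOn F ρ (B : Set (Fin m))) :
    Function.Surjective (evalOn ρ B) := by
  rw [← LinearMap.range_eq_top]
  apply Submodule.eq_top_of_finrank_eq
  rw [finrank_range_evalOn hB, Module.finrank_fintype_fun_eq_card, Fintype.card_coe]

theorem finrank_ker_evalOn {B : Finset (Fin m)} (hB : LinearIndepOn F ρ (B : Set (Fin m))) :
    Module.finrank F (LinearMap.ker (evalOn ρ B)) = n - B.card := by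
  have := (evalOn ρ B).finrank_range_add_finrank_ker
  rw [finrank_range_evalOn hB, Module.finrank_fin_fun] at this
  omega

theorem card_le_of_linearIndepOn {B : Finset (Fin m)} (hB : LinearIndepOn F ρ (B : Set (Fin m))) :
    B.card ≤ n := by
  have := (evalOn ρ B).finrank_range_add_finrank_ker
  rw [finrank_range_evalOn hB, Module.finrank_fin_fun] at this
  omega

/-- Independent equations are solvable for every right-hand side, so NBC sets give genuine flats
whatever `g` is. -/
theorem exists_mem_iInf {B : Finset (Fin m)} (hB : LinearIndepOn F ρ (B : Set (Fin m)))
    (g : Fin m → F) : ∃ p, p ∈ ⨅ j ∈ (B : Set (Fin m)), translatedArrangement ρ g j := by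
  obtain ⟨p, hp⟩ := evalOn_surjective hB fun i => g i
  refine ⟨p, mem_iInf_translatedArrangement.2 fun j hj => ?_⟩
  rw [← evalOn_apply B p ⟨j, hj⟩, hp]

theorem iInf_ne_bot {B : Finset (Fin m)} (hB : LinearIndepOn F ρ (B : Set (Fin m)))
    (g : Fin m → F) : (⨅ j ∈ (B : Set (Fin m)), translatedArrangement ρ g j) ≠ ⊥ := by
  obtain ⟨p, hp⟩ := exists_mem_iInf hB g
  rintro h
  rw [h] at hp
  exact AffineSubspace.notMem_bot _ _ _ hp

theorem finrank_direction_iInf {B : Finset (Fin m)} (hB : LinearIndepOn F ρ (B : Set (Fin m)))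
    (g : Fin m → F) :
    Module.finrank F (⨅ j ∈ (B : Set (Fin m)), translatedArrangement ρ g j).direction =
      n - B.card := by
  obtain ⟨p, hp⟩ := exists_mem_iInf hB g
  have : (⨅ j ∈ (B : Set (Fin m)), translatedArrangement ρ g j) =
      AffineSubspace.mk' p (LinearMap.ker (evalOn ρ B)) := by
    ext x
    rw [AffineSubspace.mem_mk', LinearMap.mem_ker, mem_iInf_translatedArrangement, funext_iff]
    rw [mem_iInf_translatedArrangement] at hp
    simp only [evalOn_apply, vsub_eq_sub, dotProduct_sub, Pi.zero_apply, Subtype.forall,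
      sub_eq_zero]
    exact forall₂_congr fun i hi => by rw [hp i hi]
  rw [this, AffineSubspace.direction_mk', finrank_ker_evalOn hB]

/-- A relation on `C` vanishing at some `j ∈ C` would be a nontrivial relation on the independent
set `C \ {j}`. Existence keeps the quantifier in `circuitHyperplane` from being vacuous. -/
theorem exists_isCircuitVector (hρ : IsRepresentation M ρ) {C : Set (Fin m)} (hC : M.IsCircuit C) :
    ∃ c, IsCircuitVector ρ C c := by
  classical
  have hdep : ¬ LinearIndepOn F ρ (C.toFinset : Set (Fin m)) := by
    rw [Set.coe_toFinset, ← hρ.indep_iff]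
    exact hC.not_indep
  rw [not_linearIndepOn_finset_iff] at hdep
  obtain ⟨c, hsum, i, hi, hci⟩ := hdep
  let c' : Fin m → F := fun j => if j ∈ C then c j else 0
  have hsum' : ∑ j, c' j • ρ j = 0 := by
    rw [← hsum, ← Finset.sum_filter_add_sum_filter_not Finset.univ (· ∈ C),
      Finset.sum_eq_zero (s := Finset.univ.filter fun j => ¬ j ∈ C), add_zero]
    · refine Finset.sum_congr (by ext; simp) fun j hj => ?_
      have : j ∈ C := by simpa using hj
      simp [c', this]
    · intro j hj
      have : j ∉ C := by simpa using hj
      simp [c', this]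
  refine ⟨c', hsum', fun j => ⟨fun h => by by_contra hj; simp [c', hj] at h, fun hj h0 => ?_⟩⟩
  have hind := hC.sdiff_singleton_indep hj
  rw [hρ.indep_iff, ← Set.coe_toFinset (C \ {j}), linearIndepOn_finset_iff] at hind
  have hiC : i ∈ C := by simpa using hi
  have hij : i ≠ j := by
    rintro rfl
    simp [c', hj, hci] at h0
  have := hind c' ?_ i (by simp [hiC, hij])
  · simp [c', hiC, hci] at this
  · rw [← hsum']
    refine Finset.sum_subset (Finset.subset_univ _) fun x _ hx => ?_
    by_cases hxj : x = j
    · rw [hxj, h0, zero_smul]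
    · have : x ∉ C := fun h => hx (by simp [h, hxj])
      simp [c', this]

/-- Only the residuals of `x` matter. If they vanish on `C`, then `g ∈ H_C`; if `g ∈ H_C` and they
vanish on `C \ {e}`, the one at `e` vanishes too. -/
theorem dotProduct_eq_of_isCircuitVector {C : Set (Fin m)} {c : Fin m → F}
    (hc : IsCircuitVector ρ C c) (g : Fin m → F) (x : Fin n → F) :
    c ⬝ᵥ g = ∑ i, c i * (g i - ρ i ⬝ᵥ x) := by
  have h0 : ∑ i, c i * (ρ i ⬝ᵥ x) = 0 := by
    have := congrArg (· ⬝ᵥ x) hc.1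
    simpa [sum_dotProduct, smul_dotProduct] using this
  simp only [mul_sub, Finset.sum_sub_distrib, h0, sub_zero]
  rfl

theorem isLooplessFlat_of_mem (hρ : IsRepresentation M ρ) (g : Fin m → F)
    {W : AffineSubspace F (Fin n → F)} (hW : W ≠ ⊥) :
    IsLooplessFlat M (centralCircuits ρ g) {i | M.Indep {i} ∧ W ≤ translatedArrangement ρ g i} where
  indep_singleton i hi := hi.1
  mem_of_subset C hC hsub := by
    intro c hc
    obtain ⟨x, hx⟩ := (AffineSubspace.nonempty_iff_ne_bot W).2 hW
    rw [dotProduct_eq_of_isCircuitVector hc g x]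
    refine Finset.sum_eq_zero fun i _ => ?_
    by_cases hi : i ∈ C
    · have : ρ i ⬝ᵥ x = g i := (hsub hi).2 hx
      rw [this, sub_self, mul_zero]
    · rw [not_not.1 (mt (hc.2 i).1 hi), zero_mul]
  mem_of_diff_subset C hg hC hn e he hsub := by
    refine ⟨?_, fun x hx => ?_⟩
    · refine hC.ssubset_indep ((Set.singleton_subset_iff.2 he).ssubset_of_ne ?_)
      exact hn.ne_singleton.symm
    · obtain ⟨c, hc⟩ := exists_isCircuitVector hρ hC
      have h := hg c hc
      rw [dotProduct_eq_of_isCircuitVector hc g x, Finset.sum_eq_single e] at h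
      · have hce := (hc.2 e).2 he
        exact (sub_eq_zero.1 ((mul_eq_zero.1 h).resolve_left hce)).symm
      · intro i _ hie
        by_cases hi : i ∈ C
        · have : ρ i ⬝ᵥ x = g i := (hsub ⟨hi, hie⟩).2 hx
          rw [this, sub_self, mul_zero]
        · rw [not_not.1 (mt (hc.2 i).1 hi), zero_mul]
      · simp

open Classical in
theorem charPoly_translatedArrangement (hρ : IsRepresentation M ρ) (g : Fin m → F) :
    charPoly (translatedArrangement ρ g) = nbcPoly M (centralCircuits ρ g) n := by
  let A := translatedArrangement ρ g
  -- The value `⊤` is a filler, never reached for an NBC set.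
  let f : Finset (Fin m) → flats A := fun B =>
    if h : (⨅ j ∈ (B : Set (Fin m)), A j) ≠ ⊥ then ⟨_, h, B, rfl⟩ else ⟨⊤, top_mem_flats A⟩
  have hf : ∀ B : Finset (Fin m), IsNBC M (centralCircuits ρ g) B →
      (f B : AffineSubspace F (Fin n → F)) = ⨅ j ∈ (B : Set (Fin m)), A j := fun B hB => by
    have := iInf_ne_bot ((hρ.indep_iff _).1 hB.1) g
    simp only [f]
    rw [dif_pos this]
  unfold charPoly
  refine @sum_moebius_eq_nbcPoly _ _ M (centralCircuits ρ g) _ (flats A)ᵒᵈ _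
    (Fintype.ofFinite (flats A)) (OrderDual.toDual ⟨⊤, top_mem_flats A⟩) ?_
    (fun B => OrderDual.toDual (f B))
    (fun W => {i | M.Indep {i} ∧ ((OrderDual.ofDual W).1 : AffineSubspace F (Fin n → F)) ≤ A i}) ?_
    (fun W => isLooplessFlat_of_mem hρ g (OrderDual.ofDual W).2.1) ?_
    (fun W => Module.finrank F ((OrderDual.ofDual W).1 : AffineSubspace F (Fin n → F)).direction)
    n ?_
  · intro W
    exact (le_top : (OrderDual.ofDual W).1 ≤ ⊤)
  · intro B hB W
    change (OrderDual.ofDual W).1 ≤ (f B).1 ↔ _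
    rw [hf B hB]
    simp only [le_iInf_iff]
    exact ⟨fun h i hi => ⟨hB.1.subset (Set.singleton_subset_iff.2 hi), h i hi⟩,
      fun h i hi => (h hi).2⟩
  · intro W
    obtain ⟨hW, J, hJ⟩ := (OrderDual.ofDual W).2
    constructor
    · intro h
      have : (OrderDual.ofDual W).1 = ⊤ := by
        rw [eq_top_iff, hJ]
        refine le_iInf₂ fun j hj => ?_
        have hle : (OrderDual.ofDual W).1 ≤ A j := hJ ▸ iInf₂_le j hj
        -- With no nonloop through `W`, every member cutting out `W` has zero normal; being
        -- nonempty, it is the whole space.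
        have hj0 : ρ j = 0 := by
          by_contra hne
          have : j ∈ (∅ : Set (Fin m)) := by
            rw [← h]
            exact ⟨(hρ.indep_iff _).2 (LinearIndepOn.singleton hne), hle⟩
          exact this
        obtain ⟨x, hx⟩ := (AffineSubspace.nonempty_iff_ne_bot _).2 hW
        have hx : ρ j ⬝ᵥ x = g j := hle hx
        intro y _
        change ρ j ⬝ᵥ y = g j
        rw [← hx, hj0, zero_dotProduct, zero_dotProduct]
      exact OrderDual.ofDual.injective (Subtype.ext this.symm)
    · rintro rfl
      rw [Set.eq_empty_iff_forall_notMem]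
      rintro i ⟨hi, hle⟩
      have hall : ∀ x, ρ i ⬝ᵥ x = g i := fun x => hle (AffineSubspace.mem_top F _ x)
      refine ((hρ.indep_iff _).1 hi).ne_zero (Set.mem_singleton i) ?_
      refine dotProduct_eq_zero _ fun x => ?_
      rw [hall x, ← hall 0, dotProduct_zero]
  · intro B hB
    change Module.finrank F (f B).1.direction = _
    rw [hf B hB]
    exact finrank_direction_iInf ((hρ.indep_iff _).1 hB.1) g

theorem mem_circuitHyperplane_iff_of_mem_stratum {X : AffineSubspace F (Fin m → F)}
    {g : Fin m → F} (hg : g ∈ stratum M ρ X) {C : Set (Fin m)} (hC : M.IsCircuit C) :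
    g ∈ circuitHyperplane ρ C ↔ X ≤ circuitArrangement M ρ ⟨C, hC⟩ := by
  refine ⟨fun h => ?_, fun h => h hg.1⟩
  by_contra hX
  exact hg.2 (Set.mem_iUnion₂.2 ⟨⟨C, hC⟩, hX, h, hg.1⟩)

theorem nbcPoly_congr {𝒞 𝒟 : Set (Set (Fin m))} (h : ∀ C, M.IsCircuit C → (C ∈ 𝒞 ↔ C ∈ 𝒟))
    (n : ℕ) : nbcPoly M 𝒞 n = nbcPoly M 𝒟 n := by
  have : nbcSets M 𝒞 = nbcSets M 𝒟 := by
    ext B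
    rw [mem_nbcSets, mem_nbcSets]
    exact and_congr_right fun _ => forall_congr' fun C =>
      ⟨fun H hC hC' => H ((h C hC').2 hC) hC', fun H hC hC' => H ((h C hC').1 hC) hC'⟩
  rw [nbcPoly, nbcPoly, this]

/-- On a stratum the characteristic polynomial of `A_g` depends only on the flat. -/
theorem charPoly_eq_of_mem_stratum (hρ : IsRepresentation M ρ) {X : AffineSubspace F (Fin m → F)}
    {g : Fin m → F} (hg : g ∈ stratum M ρ X) :
    charPoly (translatedArrangement ρ g) =
      nbcPoly M {C | ∃ hC : M.IsCircuit C, X ≤ circuitArrangement M ρ ⟨C, hC⟩} n := by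
  rw [charPoly_translatedArrangement hρ g]
  refine nbcPoly_congr (fun C hC => ?_) n
  exact (mem_circuitHyperplane_iff_of_mem_stratum hg hC).trans ⟨fun h => ⟨hC, h⟩, fun h => h.2⟩

theorem flatCharPoly_eq (hρ : IsRepresentation M ρ) {X : AffineSubspace F (Fin m → F)}
    (hX : (stratum M ρ X).Nonempty) :
    flatCharPoly M ρ X =
      nbcPoly M {C | ∃ hC : M.IsCircuit C, X ≤ circuitArrangement M ρ ⟨C, hC⟩} n := by
  rw [flatCharPoly, dif_pos hX]
  exact charPoly_eq_of_mem_stratum hρ hX.some_mem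

/-- Every `H_I` is linear, so an empty stratum would cover a vector space over an infinite field by
finitely many proper subspaces. -/
theorem stratum_nonempty [Infinite F] {X : AffineSubspace F (Fin m → F)}
    (hX : X ∈ flats (circuitArrangement M ρ)) : (stratum M ρ X).Nonempty := by
  classical
  obtain ⟨-, J, rfl⟩ := hX
  let A := circuitArrangement M ρ
  let S : Submodule F (Fin m → F) := ⨅ j ∈ J, circuitHyperplane ρ j.1
  have hS : ∀ y, y ∈ (⨅ j ∈ J, A j) ↔ y ∈ S := fun y => by
    simp only [AffineSubspace.mem_iInf_iff, S, Submodule.mem_iInf]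
    rfl
  by_contra hempty
  let p : {i // ¬ (⨅ j ∈ J, A j) ≤ A i} → Submodule F S :=
    fun i => (circuitHyperplane ρ i.1.1).comap S.subtype
  have hcover : ⋃ i, (p i : Set S) = Set.univ := by
    refine Set.eq_univ_of_forall fun y => ?_
    by_contra hy
    refine hempty ⟨y, (hS y).2 y.2, fun h => hy ?_⟩
    obtain ⟨i, hi, hyi, -⟩ := Set.mem_iUnion₂.1 h
    exact Set.mem_iUnion.2 ⟨⟨i, hi⟩, hyi⟩
  obtain ⟨i, hi⟩ := Subspace.exists_eq_top_of_iUnion_eq_univ hcover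
  refine i.2 fun y hy => ?_
  have : (⟨y, (hS y).1 hy⟩ : S) ∈ p i := hi ▸ Submodule.mem_top
  exact this

theorem card_le_of_indep (hρ : IsRepresentation M ρ) (B : Finset (Fin m)) (hB : M.Indep B) :
    B.card ≤ n :=
  card_le_of_linearIndepOn ((hρ.indep_iff _).1 hB)

theorem le_of_le_eRank (hρ : IsRepresentation M ρ) {k : ℕ} (hk : (k : ℕ∞) ≤ M.eRank) : k ≤ n := by
  classical
  obtain ⟨B, hB⟩ := M.exists_isBase
  have h := card_le_of_indep hρ B.toFinset (by simpa using hB.indep)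
  rw [← hB.encard_eq_eRank, ← Set.coe_toFinset B, Set.encard_coe_eq_coe_finsetCard] at hk
  exact (Nat.cast_le.1 hk).trans h

end Arrangement

end TranslationDeformation

open TranslationDeformation
theorem theorem3p2 {F : Type*} [Field F] {m n : ℕ} (M : Matroid (Fin m))
    (ρ : Fin m → Fin n → F) (hρ : IsRepresentation M ρ) :
    -- `χ(X, t)` is the common characteristic polynomial of the `A_g` with `g ∈ M(A^ρ/X)`
    (∀ X ∈ flats (circuitArrangement M ρ), ∀ g ∈ stratum M ρ X,
      charPoly (translatedArrangement ρ g) = flatCharPoly M ρ X) ∧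
    -- over an infinite field it is defined for every flat `X`
    (Infinite F → ∀ X ∈ flats (circuitArrangement M ρ), (stratum M ρ X).Nonempty) ∧
    -- comparison along an inclusion of flats
    (∀ X ∈ flats (circuitArrangement M ρ), ∀ Y ∈ flats (circuitArrangement M ρ), X ≤ Y →
      (stratum M ρ X).Nonempty → (stratum M ρ Y).Nonempty →
      ∀ k : ℕ, (k : ℕ∞) ≤ M.eRank → coeffFlat M ρ X k ≤ coeffFlat M ρ Y k) ∧
    -- comparison with the matroid itself
    (∀ g : Fin m → F, ∀ k : ℕ, (k : ℕ∞) ≤ M.eRank →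
      coeffMatroid M n k ≤ coeffVector ρ g k) := by
  refine ⟨fun X _ g hg => ?_, fun _ X hX => stratum_nonempty hX, ?_, ?_⟩
  · rw [charPoly_eq_of_mem_stratum hρ hg, flatCharPoly_eq hρ ⟨g, hg⟩]
  · intro X _ Y _ hXY hX hY k hk
    rw [coeffFlat, coeffFlat, flatCharPoly_eq hρ hX, flatCharPoly_eq hρ hY]
    exact unsignedCoeff_nbcPoly_anti (le_of_le_eRank hρ hk) (card_le_of_indep hρ)
      fun C ⟨hC, h⟩ => ⟨hC, hXY.trans h⟩
  · intro g k hk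
    rw [coeffMatroid, coeffVector, matroidCharPoly_eq_nbcPoly M hρ.ground_eq,
      charPoly_translatedArrangement hρ]
    exact unsignedCoeff_nbcPoly_anti (le_of_le_eRank hρ hk) (card_le_of_indep hρ)
      (Set.subset_univ _)
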